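/- Consider the congested clique model on $n$ vertices with IDs $1,\dots,n$: initially each vertex knows $n$, $k$, its own ID and the IDs of its neighbours in an input graph $G$; in every synchronous round each vertex sends a (possibly different) message of $O(\log n)$ bits to every vertex; local computation is unrestricted. For an unweighted $n$-vertex graph $G$, call a vertex $v$ *heavy* if $\deg(v,G)\ge\sqrt n$, and let $G_{light}=G[V\setminus V_{heavy}]$ be the subgraph induced on the non-heavy vertices. For an integer $k\ge 6$ let $r=k/2-1$ if $k$ is even and $r=\lfloor k/2\rfloor$ if $k$ is odd, and for $u\in V(G_{light})$ let $\Gamma_r(u,G_{light})$ be the set of vertices at distance at most $r$ from $u$ in $G_{light}$. Let $N_r(u)$ be the set of the $\min\{n^{1/2-1/k},|\Gamma_r(u,G_{light})|\}$ vertices of $\Gamma_r(u,G_{light})$ closest to $u$ in $G_{light}$, ties broken by IDs, where $n^{1/2-1/k}$ is rounded to an integer (either down or up). A *truncated BFS tree* $T_r(u)$ is a tree on the vertex set $N_r(u)$, rooted at $u$, whose edges are edges of $G_{light}$ and in which the path from $u$ to each $v\in N_r(u)$ is a shortest $u$-$v$ path of $G_{light}$. Lemma. There is a deterministic congested clique algorithm,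 NearestNeighbors, such that for every $n$, every $k\ge 6$ and every $n$-vertex graph $G$, within $O(\log k)$ rounds every non-heavy vertex $u$ knows (outputs) an entire truncated BFS tree $T_r(u)$. The constants in the message size and in the number of rounds are absolute. -/

import Mathlib

/-- A deterministic algorithm in the congested clique on the vertices `Fin n` (a vertex is its own
ID), where every message has `b` bits. Local computation is unrestricted. At the start a vertex
knows only its ID and the IDs of its neighbours in the input graph. In each round it sends one
message to every vertex, which may be different for different recipients, and it then updates its
state from the messages received (`step s msg`, where `msg w` is the message from `w`). -/
structure CliqueAlgorithm (n b : ℕ) (Output : Type) where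
  State : Type
  init : Fin n → Set (Fin n) → State
  send : State → Fin n → (Fin b → Bool)
  step : State → (Fin n → (Fin b → Bool)) → State
  output : State → Output

namespace CliqueAlgorithm

variable {n b : ℕ} {Output : Type}

/-- The state of each vertex after `t` rounds on the input graph `G`. -/
def stateAfter (A : CliqueAlgorithm n b Output) (G : SimpleGraph (Fin n)) : ℕ → Fin n → A.State
  | 0, v => A.init v (G.neighborSet v)
  | t + 1, v => A.step (A.stateAfter G t v) (fun w => A.send (A.stateAfter G t w) v)

/-- What vertex `v` outputs, from its own state, after `t` rounds on the input graph `G`. -/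
def outputAfter (A : CliqueAlgorithm n b Output) (G : SimpleGraph (Fin n)) (t : ℕ) (v : Fin n) :
    Output :=
  A.output (A.stateAfter G t v)

end CliqueAlgorithm

namespace NearestNeighbors

variable {n : ℕ}

/-- A vertex is heavy if its degree is at least `√n`. -/
def IsHeavy (G : SimpleGraph (Fin n)) (v : Fin n) : Prop :=
  Real.sqrt n ≤ ((G.neighborSet v).ncard : ℝ)

/-- The subgraph induced on the non-heavy vertices. It is kept on the vertex type `Fin n`, where
the heavy vertices are isolated; this affects no distance between non-heavy vertices, and no
heavy vertex is reachable from a non-heavy one. -/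
def lightGraph (G : SimpleGraph (Fin n)) : SimpleGraph (Fin n) :=
  (G.induce {v | ¬ IsHeavy G v}).spanningCoe

/-- The vertices at distance at most `r` from `u` in `H`. -/
def ball (H : SimpleGraph (Fin n)) (u : Fin n) (r : ℕ) : Set (Fin n) :=
  {v | H.edist u v ≤ (r : ℕ∞)}

/-- `w` comes before `v` in the order by distance from `u`, ties broken by IDs. -/
def Closer (H : SimpleGraph (Fin n)) (u w v : Fin n) : Prop :=
  H.edist u w < H.edist u v ∨ (H.edist u w = H.edist u v ∧ w < v)

/-- The first `min m |ball H u r|` vertices of `ball H u r` in the order `Closer H u`. -/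
def nearest (H : SimpleGraph (Fin n)) (u : Fin n) (r m : ℕ) : Set (Fin n) :=
  {v | v ∈ ball H u r ∧ {w | w ∈ ball H u r ∧ Closer H u w v}.ncard < m}

/-- `T` is a tree on the vertex set `N`, all of whose edges are edges of `H`, in which the path
from `u` to each vertex of `N` is a shortest path of `H`. -/
def IsBFSTreeOn (H : SimpleGraph (Fin n)) (u : Fin n) (N : Set (Fin n))
    (T : (⊤ : SimpleGraph (Fin n)).Subgraph) : Prop :=
  T.verts = N ∧ T.spanningCoe ≤ H ∧ T.coe.IsTree ∧
    ∀ v ∈ N, T.spanningCoe.edist u v = H.edist u v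

/-- The radius: `k / 2 - 1` for even `k`, and `⌊k / 2⌋` for odd `k`. -/
def radius (k : ℕ) : ℕ :=
  if Even k then k / 2 - 1 else k / 2

/-- `m` is the real number `n ^ (1 / 2 - 1 / k)` rounded to an integer, either down or up. -/
def IsSizeBound (n k m : ℕ) : Prop :=
  m = ⌊(n : ℝ) ^ ((1 : ℝ) / 2 - 1 / (k : ℝ))⌋₊ ∨ m = ⌈(n : ℝ) ^ ((1 : ℝ) / 2 - 1 / (k : ℝ))⌉₊

end NearestNeighbors

/-!
The algorithm doubles the radius of the truncated neighbourhoods. It is run in the light graph `H`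
by every vertex, heavy ones included (they are isolated in `H`). Write `N_ρ(u)` for the `m` nearest
vertices of `u` within distance `ρ`; a vertex stores `N_ρ(u)` as the partial distance function
`nearDist H m u ρ`, which is finite exactly on `N_ρ(u)`.

Combinatorics. Let `v ∈ N_σ(u)` and let `w` lie on a shortest path from `u` to `v`. Then `w` is
among the nearest vertices of `u` (`mem_nearest_of_between_left`), and `v` is among the nearest
vertices of `w` (`mem_nearest_of_between_right`), since every vertex that `w` prefers to `v` is also
preferred to `v` by `u`. With `w` halfway along the path, the tables `N_ρ` of `u` and of the members
of `N_ρ(u)` give the exact distance to every member of `N_{2ρ}(u)`, and no estimate that is too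
small for any vertex; hence they determine `N_{2ρ}(u)` (`trunc_minPlus_nearDist`). With `w` the last
vertex before `v`, the tables `N_1` of the members of `N_r(u)` contain, for each `v ≠ u` in `N_r(u)`,
an edge to a parent `w ∈ N_r(u)` that is one step closer to `u` (`exists_parent`). Such parents form
a BFS tree (`isBFSTreeOn_parentTree`).

Communication. It remains to let every `u` learn the tables of all members of `N_ρ(u)` in `O(1)`
rounds. A table is a list of at most `m` words, and `m² ≤ 4n`, so that every pair `(i, j)` with
`i, j < m` can be assigned to a vertex that is in charge of at most four pairs. The vertex in charge
of `(i, j)` collects from every vertex the `j`-th word of its table and the name of its `i`-th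
nearest vertex, and then answers each request (`ComputableIn.fetch`). No general routing scheme is
needed, and it does not matter how many vertices ask for the same table. A message consists of at
most twelve numbers below `n`.

One round makes the light graph known locally, `log₂ k` doublings of two rounds each reach the
required radius, and two final rounds give the parents.
-/

/-! ### Composing congested clique algorithms -/

namespace CliqueAlgorithm

variable {n b t : ℕ} {S S' : Type}

/-- The family `f` of local values can be computed in `t` rounds with messages of `b` bits: some
algorithm makes every vertex `v` of every graph `G` output `f G v` after `t` rounds. -/
def ComputableIn (b t : ℕ) (f : SimpleGraph (Fin n) → Fin n → S) : Prop :=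
  ∃ A : CliqueAlgorithm n b S, ∀ G v, A.outputAfter G t v = f G v

theorem ComputableIn.init (b : ℕ) (g : Fin n → Set (Fin n) → S) :
    ComputableIn b 0 (fun G v => g v (G.neighborSet v)) :=
  ⟨{ State := S, init := g, send := fun _ _ _ => false, step := fun s _ => s, output := id },
    fun _ _ => rfl⟩

theorem ComputableIn.congr {f f' : SimpleGraph (Fin n) → Fin n → S} (hf : ComputableIn b t f)
    (h : ∀ G v, f G v = f' G v) : ComputableIn b t f' := by
  obtain ⟨A, hA⟩ := hf
  exact ⟨A, fun G v => (hA G v).trans (h G v)⟩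

theorem ComputableIn.map {f : SimpleGraph (Fin n) → Fin n → S} (hf : ComputableIn b t f)
    (g : S → S') : ComputableIn b t (fun G v => g (f G v)) := by
  obtain ⟨A, hA⟩ := hf
  let B : CliqueAlgorithm n b S' :=
    { State := A.State, init := A.init, send := A.send, step := A.step,
      output := fun s => g (A.output s) }
  have key : ∀ G t v, B.stateAfter G t v = A.stateAfter G t v := by
    intro G t
    induction t with
    | zero => intro v; rfl
    | succ t ih => intro v; simp only [stateAfter, ih]; rfl
  refine ⟨B, fun G v => ?_⟩
  simp only [← hA G v, outputAfter, key]
  rfl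

/-- The algorithm that runs `A` for `t` rounds, counting them, and then performs one more round in
which the messages and the result depend only on the outputs of `A`. -/
def addRound (A : CliqueAlgorithm n b S) (t : ℕ) (send : S → Fin n → (Fin b → Bool))
    (step : S → (Fin n → (Fin b → Bool)) → S') : CliqueAlgorithm n b S' where
  State := (ℕ × A.State) ⊕ S'
  init v N := Sum.inl (0, A.init v N)
  send
    | Sum.inl (i, s) => if i < t then A.send s else send (A.output s)
    | Sum.inr _ => fun _ _ => false
  step
    | Sum.inl (i, s), msg =>
        if i < t then Sum.inl (i + 1, A.step s msg) else Sum.inr (step (A.output s) msg)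
    | Sum.inr s, _ => Sum.inr s
  output
    | Sum.inl (_, s) => step (A.output s) (fun _ _ => false)
    | Sum.inr s => s

theorem outputAfter_addRound (A : CliqueAlgorithm n b S) (t : ℕ)
    (send : S → Fin n → (Fin b → Bool)) (step : S → (Fin n → (Fin b → Bool)) → S')
    (G : SimpleGraph (Fin n)) (v : Fin n) :
    (A.addRound t send step).outputAfter G (t + 1) v =
      step (A.outputAfter G t v) (fun w => send (A.outputAfter G t w) v) := by
  have key : ∀ i ≤ t, ∀ v,
      (A.addRound t send step).stateAfter G i v = Sum.inl (i, A.stateAfter G i v) := by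
    intro i
    induction i with
    | zero => intro _ v; rfl
    | succ i ih =>
      intro hi v
      have hi' : i < t := hi
      simp only [stateAfter, ih hi'.le]
      simp [addRound, hi']
  simp only [outputAfter, stateAfter, key t le_rfl]
  simp [addRound]

/-- One round whose messages come from an arbitrary type with at most `2 ^ b` elements. -/
theorem ComputableIn.round {f : SimpleGraph (Fin n) → Fin n → S} (hf : ComputableIn b t f)
    {M : Type} [Fintype M] (hM : Fintype.card M ≤ 2 ^ b) (send : S → Fin n → M)
    (step : S → (Fin n → M) → S') :
    ComputableIn b (t + 1) (fun G v => step (f G v) (fun w => send (f G w) v)) := by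
  obtain ⟨A, hA⟩ := hf
  obtain ⟨e⟩ : Nonempty (M ↪ (Fin b → Bool)) :=
    Function.Embedding.nonempty_of_card_le (by simpa using hM)
  -- Bit strings that encode no message are never received; they are decoded to `send s w`.
  refine ⟨A.addRound t (fun s w => e (send s w))
    (fun s msg => step s fun w => Function.extend e id (fun _ => send s w) (msg w)), fun G v => ?_⟩
  simp [outputAfter_addRound, hA, e.injective.extend_apply]

/-- If every vertex holds a list of `m` words and the names of `m` vertices, where `m ^ 2 ≤ 4 * n`,
then two rounds suffice for every vertex to learn the full lists of all the vertices it names,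
however often a single vertex is named. The pairs `(i, j)` are distributed over the vertices, at
most four to each. The vertex `x` in charge of `(i, j)` receives from every vertex the `j`-th word
of its list and the `i`-th name it asks for, and so can forward to every vertex the `j`-th word of
the list of the `i`-th vertex asked for. -/
theorem ComputableIn.fetch {f : SimpleGraph (Fin n) → Fin n → S} (hf : ComputableIn b t f)
    {m : ℕ} (hm : 0 < m) (hmn : m * m ≤ 4 * n) {W : Type} [Fintype W]
    (hW : (Fintype.card W * n) ^ 4 ≤ 2 ^ b) (words : S → Fin m → W) (names : S → Fin m → Fin n) :
    ComputableIn b (t + 2)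
      (fun G v => (f G v, fun i j => words (f G (names (f G v) i)) j)) := by
  rcases Nat.eq_zero_or_pos n with rfl | hn
  · exact absurd hmn (Nat.not_le.2 (Nat.mul_pos hm hm))
  obtain ⟨e⟩ : Nonempty (Fin m × Fin m ↪ Fin n × Fin 4) :=
    Function.Embedding.nonempty_of_card_le (by simpa [mul_comm] using hmn)
  have : Nonempty (Fin m × Fin m) := ⟨(⟨0, hm⟩, ⟨0, hm⟩)⟩
  let p : Fin n × Fin 4 → Fin m × Fin m := Function.invFun e
  have hp : ∀ ij, p (e ij) = ij := Function.leftInverse_invFun e.injective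
  have h₁ := hf.round (M := Fin 4 → W × Fin n) (by simpa using hW)
    (fun s x k => (words s (p (x, k)).2, names s (p (x, k)).1)) (fun s msg => (s, msg))
  have h₂ := h₁.round (M := Fin 4 → W)
    (by
      refine le_trans ?_ hW
      simpa using Nat.pow_le_pow_left (Nat.le_mul_of_pos_right _ hn) 4)
    (fun s u k => (s.2 (s.2 u k).2 k).1)
    (fun s msg => (s.1, fun i j => msg (e (i, j)).1 (e (i, j)).2))
  simpa [hp] using h₂

end CliqueAlgorithm

/-! ### The first elements of a partial distance function -/

namespace NearestNeighbors

variable {n : ℕ}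

/-- The vertices ordered by the value of `D`, ties broken by IDs. -/
def key (D : Fin n → ℕ∞) (v : Fin n) : ℕ∞ ×ₗ Fin n := toLex (D v, v)

theorem key_injective (D : Fin n → ℕ∞) : Function.Injective (key D) := fun _ _ h =>
  congrArg (fun x => (ofLex x).2) h

theorem key_lt_key {D : Fin n → ℕ∞} {v w : Fin n} :
    key D w < key D v ↔ D w < D v ∨ (D w = D v ∧ w < v) := by
  simp [key, Prod.Lex.toLex_lt_toLex]

theorem key_mono {D P : Fin n → ℕ∞} {v : Fin n} (h : D v ≤ P v) : key D v ≤ key P v :=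
  Prod.Lex.toLex_mono ⟨h, le_rfl⟩

/-- The first `m` vertices, in the order `key D`, of those where `D` is finite. -/
def firstSet (D : Fin n → ℕ∞) (m : ℕ) : Set (Fin n) :=
  {v | D v ≠ ⊤ ∧ {w | D w ≠ ⊤ ∧ key D w < key D v}.ncard < m}

open Classical in
/-- `D` restricted to its first `m` vertices, and infinite elsewhere. -/
noncomputable def trunc (m : ℕ) (D : Fin n → ℕ∞) (v : Fin n) : ℕ∞ :=
  if v ∈ firstSet D m then D v else ⊤

theorem ncard_firstSet (D : Fin n → ℕ∞) (m : ℕ) :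
    (firstSet D m).ncard = min m {v | D v ≠ ⊤}.ncard := by
  classical
  let s : Finset (Fin n) := {v | D v ≠ ⊤}
  let rank : Fin n → ℕ := fun v => (s.filter fun w => key D w < key D v).card
  have hs : {v | D v ≠ ⊤} = (s : Set (Fin n)) := by simp [s]
  have hf : firstSet D m = (s.filter fun v => rank v < m : Finset (Fin n)) := by
    ext v
    have : {w | D w ≠ ⊤ ∧ key D w < key D v} =
        ((s.filter fun w => key D w < key D v : Finset (Fin n)) : Set (Fin n)) := by
      ext; simp [s]
    rw [firstSet, Set.mem_ofPred_eq, this, Set.ncard_coe_finset]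
    simp only [Finset.coe_filter, Set.mem_ofPred_eq, rank]
    exact and_congr_left fun _ => by simp [s]
  have hlt : ∀ v ∈ s, ∀ w ∈ s, key D v < key D w → rank v < rank w := by
    intro v hv w _ hvw
    refine Finset.card_lt_card ⟨fun x hx => ?_, fun h => ?_⟩
    · simp only [Finset.mem_filter] at hx ⊢
      exact ⟨hx.1, hx.2.trans hvw⟩
    · have := h (Finset.mem_filter.2 ⟨hv, hvw⟩)
      simp at this
  have hinj : Set.InjOn rank s := by
    intro v hv w hw h
    rcases lt_trichotomy (key D v) (key D w) with h' | h' | h'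
    · exact absurd h (hlt v hv w hw h').ne
    · exact key_injective D h'
    · exact absurd h (hlt w hw v hv h').ne'
  -- The rank is injective on `s` and less than `#s`, so it takes every value below `#s` once.
  have himg : s.image rank = Finset.range s.card := by
    refine Finset.eq_of_subset_of_card_le (fun x hx => ?_) ?_
    · obtain ⟨v, hv, rfl⟩ := Finset.mem_image.1 hx
      refine Finset.mem_range.2 (Finset.card_lt_card ⟨Finset.filter_subset _ _, fun h => ?_⟩)
      have := h hv
      simp at this
    · rw [Finset.card_image_of_injOn hinj, Finset.card_range]
  rw [hf, hs, Set.ncard_coe_finset, Set.ncard_coe_finset,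
    ← Finset.card_image_of_injOn (hinj.mono (Finset.coe_subset.2 (Finset.filter_subset _ _)))]
  have hfi : (s.filter fun v => rank v < m).image rank = (s.image rank).filter (· < m) := by
    rw [Finset.filter_image]
  rw [hfi, himg]
  have : (Finset.range s.card).filter (· < m) = Finset.range (min m s.card) := by
    ext; simp [and_comm]
  rw [this, Finset.card_range]

/-- Upper bounds `P` of `D` that are exact on the first `m` vertices of `D` have the same first `m`
vertices: the overestimated ones can only move further back. -/
theorem trunc_congr {D P : Fin n → ℕ∞} {m : ℕ} (hDP : ∀ v, D v ≤ P v)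
    (h : ∀ v ∈ firstSet D m, P v ≤ D v) : trunc m P = trunc m D := by
  have heq : ∀ v ∈ firstSet D m, P v = D v := fun v hv => (h v hv).antisymm (hDP v)
  have hkey : ∀ v ∈ firstSet D m, key P v = key D v := fun v hv => by simp [key, heq v hv]
  have hD : ∀ v, P v ≠ ⊤ → D v ≠ ⊤ := fun v hv hd => hv (top_le_iff.1 (hd ▸ hDP v))
  have hset : firstSet P m = firstSet D m := by
    ext v
    constructor
    · rintro ⟨hv, hrank⟩
      by_contra hnot
      have hge : m ≤ {w | D w ≠ ⊤ ∧ key D w < key D v}.ncard := by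
        by_contra hlt
        exact hnot ⟨hD v hv, not_le.1 hlt⟩
      have hcard : (firstSet D m).ncard = m := by
        rw [ncard_firstSet, min_eq_left]
        exact hge.trans (Set.ncard_le_ncard fun w hw => hw.1)
      refine absurd hrank (not_lt.2 ?_)
      rw [← hcard]
      refine Set.ncard_le_ncard fun w hw => ⟨by rw [heq w hw]; exact hw.1, ?_⟩
      rw [hkey w hw]
      refine lt_of_lt_of_le (lt_of_not_ge fun hle => ?_) (key_mono (hDP v))
      refine absurd hw.2 (not_lt.2 (hge.trans ?_))
      exact Set.ncard_le_ncard fun x hx => ⟨hx.1, hx.2.trans_le hle⟩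
    · intro hv
      refine ⟨by rw [heq v hv]; exact hv.1, lt_of_le_of_lt ?_ hv.2⟩
      refine Set.ncard_le_ncard fun w hw => ⟨hD w hw.1, ?_⟩
      rw [← hkey v hv]
      exact (key_mono (hDP w)).trans_lt hw.2
  funext v
  unfold trunc
  rw [hset]
  split_ifs with hv
  · exact heq v hv
  · rfl

/-! ### Truncated distances in a graph -/

variable {H : SimpleGraph (Fin n)} {u v w : Fin n} {m ρ σ : ℕ}

open Classical in
/-- The distance from `u` on the ball of radius `ρ`, and infinity elsewhere. -/
noncomputable def ballDist (H : SimpleGraph (Fin n)) (u : Fin n) (ρ : ℕ) (v : Fin n) : ℕ∞ :=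
  if v ∈ ball H u ρ then H.edist u v else ⊤

open Classical in
/-- The distance from `u` on the `m` nearest vertices of the ball of radius `ρ`, and infinity
elsewhere. -/
noncomputable def nearDist (H : SimpleGraph (Fin n)) (m : ℕ) (u : Fin n) (ρ : ℕ) (v : Fin n) :
    ℕ∞ :=
  if v ∈ nearest H u ρ m then H.edist u v else ⊤

theorem ball_mono (h : ρ ≤ σ) : ball H u ρ ⊆ ball H u σ := fun _ hv =>
  le_trans (b := (ρ : ℕ∞)) hv (by exact_mod_cast h)

theorem ne_top_of_mem_ball (h : v ∈ ball H u ρ) : H.edist u v ≠ ⊤ :=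
  ne_top_of_le_ne_top (ENat.natCast_ne_top ρ) h

theorem ballDist_of_mem (h : v ∈ ball H u ρ) : ballDist H u ρ v = H.edist u v := if_pos h

theorem ballDist_ne_top : ballDist H u ρ v ≠ ⊤ ↔ v ∈ ball H u ρ := by
  unfold ballDist
  split_ifs with h
  · simp [h, ne_top_of_mem_ball h]
  · simp [h]

theorem firstSet_ballDist (H : SimpleGraph (Fin n)) (u : Fin n) (ρ m : ℕ) :
    firstSet (ballDist H u ρ) m = nearest H u ρ m := by
  ext v
  simp only [firstSet, nearest, Set.mem_ofPred_eq, ballDist_ne_top]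
  refine and_congr_right fun hv => ?_
  have : {w | w ∈ ball H u ρ ∧ key (ballDist H u ρ) w < key (ballDist H u ρ) v} =
      {w | w ∈ ball H u ρ ∧ Closer H u w v} := by
    ext w
    simp only [Set.mem_ofPred_eq]
    refine and_congr_right fun hw => ?_
    rw [key_lt_key, ballDist_of_mem hw, ballDist_of_mem hv, Closer]
  rw [this]

theorem trunc_ballDist (H : SimpleGraph (Fin n)) (u : Fin n) (ρ m : ℕ) :
    trunc m (ballDist H u ρ) = nearDist H m u ρ := by
  funext v
  unfold trunc nearDist
  rw [firstSet_ballDist]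
  split_ifs with h
  · exact ballDist_of_mem h.1
  · rfl

theorem nearDist_of_mem (h : v ∈ nearest H u ρ m) : nearDist H m u ρ v = H.edist u v := if_pos h

theorem nearDist_ne_top : nearDist H m u ρ v ≠ ⊤ ↔ v ∈ nearest H u ρ m := by
  unfold nearDist
  split_ifs with h
  · simp [h, ne_top_of_mem_ball h.1]
  · simp [h]

theorem le_nearDist : H.edist u v ≤ nearDist H m u ρ v := by
  unfold nearDist
  split_ifs
  · exact le_rfl
  · exact le_top

theorem self_mem_nearest (hm : 0 < m) : u ∈ nearest H u ρ m := by
  have : {w | w ∈ ball H u ρ ∧ Closer H u w u} = ∅ := by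
    ext w
    simp only [Set.mem_ofPred_eq, Set.mem_empty_iff_false, iff_false, not_and]
    rintro - (h | ⟨h, h'⟩)
    · simp at h
    · rw [SimpleGraph.edist_self, SimpleGraph.edist_eq_zero_iff] at h
      exact absurd h' (by simp [h])
  exact ⟨by simp [ball], by rwa [this, Set.ncard_empty]⟩

theorem ncard_nearest_le : (nearest H u ρ m).ncard ≤ m := by
  rw [← firstSet_ballDist, ncard_firstSet]
  exact min_le_left _ _

theorem edist_lt_of_mem_ball (h : v ∈ ball H u ρ) : H.edist u v < n := by
  have hr : H.Reachable u v := SimpleGraph.reachable_of_edist_ne_top (ne_top_of_mem_ball h)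
  obtain ⟨p, hp, hlen⟩ := hr.exists_path_of_dist
  rw [← hr.coe_dist_eq_edist, ← hlen]
  exact_mod_cast hp.length_lt.trans_eq (Fintype.card_fin n)

/-- A vertex on a shortest path from `u` to one of the nearest vertices of `u` is itself among the
nearest vertices of `u`. -/
theorem mem_nearest_of_between_left (hv : v ∈ nearest H u σ m)
    (h : H.edist u w + H.edist w v ≤ H.edist u v) (hρ : ρ ≤ σ) (hw : w ∈ ball H u ρ) :
    w ∈ nearest H u ρ m := by
  refine ⟨hw, lt_of_le_of_lt (Set.ncard_le_ncard fun x hx => ?_) hv.2⟩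
  refine ⟨ball_mono hρ hx.1, ?_⟩
  rcases eq_or_ne w v with rfl | hne
  · exact hx.2
  left
  have hlt : H.edist u w < H.edist u v := by
    refine lt_of_lt_of_le ?_ h
    rw [add_comm]
    exact ENat.lt_add_left (ne_top_of_mem_ball hw) (SimpleGraph.edist_pos_of_ne hne)
  rcases hx.2 with h' | ⟨h', -⟩
  · exact h'.trans hlt
  · exact h'.trans_lt hlt

/-- If `w` lies on a shortest path from `u` to one of the nearest vertices `v` of `u`, then `v` is
among the nearest vertices of `w`: every vertex that `w` prefers to `v` is also preferred by `u`. -/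
theorem mem_nearest_of_between_right (hv : v ∈ nearest H u σ m)
    (h : H.edist u w + H.edist w v ≤ H.edist u v) (hw : v ∈ ball H w ρ) :
    v ∈ nearest H w ρ m := by
  have hle : H.edist u w ≤ H.edist u v := le_self_add.trans h
  have htop : H.edist u w ≠ ⊤ := ne_top_of_le_ne_top (ne_top_of_mem_ball hv.1) hle
  refine ⟨hw, lt_of_le_of_lt (Set.ncard_le_ncard fun x hx => ?_) hv.2⟩
  have hcloser : Closer H u x v := by
    rcases hx.2 with h' | ⟨h', hlt⟩
    · left
      calc H.edist u x ≤ H.edist u w + H.edist w x := H.edist_triangle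
        _ < H.edist u w + H.edist w v := (ENat.add_lt_add_iff_left htop).2 h'
        _ ≤ H.edist u v := h
    · have : H.edist u x ≤ H.edist u v :=
        le_trans H.edist_triangle (by rw [h']; exact h)
      rcases this.lt_or_eq with h'' | h''
      · exact Or.inl h''
      · exact Or.inr ⟨h'', hlt⟩
  refine ⟨?_, hcloser⟩
  have : H.edist u x ≤ H.edist u v := by
    rcases hcloser with h' | h'
    · exact h'.le
    · exact h'.1.le
  exact this.trans hv.1

theorem exists_between (h : v ∈ ball H u (ρ + σ)) :
    ∃ w, w ∈ ball H u ρ ∧ v ∈ ball H w σ ∧ H.edist u w + H.edist w v ≤ H.edist u v := by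
  obtain ⟨p, hp⟩ := SimpleGraph.exists_walk_of_edist_ne_top (ne_top_of_mem_ball h)
  have hlen : p.length ≤ ρ + σ := by
    have : (p.length : ℕ∞) ≤ ((ρ + σ : ℕ) : ℕ∞) := hp ▸ h
    exact_mod_cast this
  have h₁ : H.edist u (p.getVert ρ) ≤ (min ρ p.length : ℕ) := by
    have := SimpleGraph.edist_le (p.take ρ)
    rwa [SimpleGraph.Walk.take_length] at this
  have h₂ : H.edist (p.getVert ρ) v ≤ (p.length - ρ : ℕ) := by
    have := SimpleGraph.edist_le (p.drop ρ)
    rwa [SimpleGraph.Walk.drop_length] at this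
  refine ⟨p.getVert ρ, h₁.trans (by exact_mod_cast min_le_left _ _),
    h₂.trans (by exact_mod_cast (by omega)), ?_⟩
  rw [← hp]
  refine (add_le_add h₁ h₂).trans ?_
  exact_mod_cast (by omega)

/-- The doubling step: truncated distances to radius `ρ` determine those to radius `ρ + ρ` as a
truncated min-plus product. -/
theorem trunc_minPlus_nearDist (H : SimpleGraph (Fin n)) (m : ℕ) (u : Fin n) (ρ : ℕ) :
    trunc m (fun v => ⨅ w, nearDist H m u ρ w + nearDist H m w ρ v) =
      nearDist H m u (ρ + ρ) := by
  rw [← trunc_ballDist H u (ρ + ρ) m]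
  refine trunc_congr (fun v => le_iInf fun w => ?_) fun v hv => ?_
  · by_cases hw : w ∈ nearest H u ρ m
    · by_cases hv : v ∈ nearest H w ρ m
      · rw [nearDist_of_mem hw, nearDist_of_mem hv, ballDist_of_mem]
        · exact H.edist_triangle
        · refine le_trans H.edist_triangle ((add_le_add hw.1 hv.1).trans ?_)
          simp
      · rw [not_not.1 (mt nearDist_ne_top.1 hv)]
        simp
    · rw [not_not.1 (mt nearDist_ne_top.1 hw)]
      simp
  · rw [firstSet_ballDist] at hv
    obtain ⟨w, hw, hwv, h⟩ := exists_between hv.1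
    refine iInf_le_of_le w ?_
    rw [nearDist_of_mem (mem_nearest_of_between_left hv h (Nat.le_add_left _ _) hw),
      nearDist_of_mem (mem_nearest_of_between_right hv h hwv), ballDist_of_mem hv.1]
    exact h

theorem mem_nearest_iff_of_le (h : ρ ≤ σ) :
    v ∈ nearest H u ρ m ↔ nearDist H m u σ v ≤ ρ := by
  constructor
  · intro hv
    have hv' : v ∈ nearest H u σ m := by
      refine ⟨ball_mono h hv.1, lt_of_le_of_lt ?_ hv.2⟩
      refine Set.ncard_le_ncard fun x hx =>
        ⟨le_trans (b := H.edist u v) ?_ hv.1, hx.2⟩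
      rcases hx.2 with h' | h'
      · exact h'.le
      · exact h'.1.le
    rw [nearDist_of_mem hv']
    exact hv.1
  · intro hv
    have hv' : v ∈ nearest H u σ m :=
      nearDist_ne_top.1 (ne_top_of_le_ne_top (ENat.natCast_ne_top ρ) hv)
    exact mem_nearest_of_between_left hv' (by simp) h (le_nearDist.trans hv)

end NearestNeighbors

/-! ### Exchanging tables of distances -/

namespace NearestNeighbors

open CliqueAlgorithm

variable {n m : ℕ}

/-- A partial distance function that can be communicated as a nonempty list of at most `m` pairs
consisting of a vertex and its distance. -/
structure IsTable (m : ℕ) (D : Fin n → ℕ∞) : Prop where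
  exists_ne_top : ∃ v, D v ≠ ⊤
  ncard_le : {v | D v ≠ ⊤}.ncard ≤ m
  lt_of_ne_top : ∀ v, D v ≠ ⊤ → D v < n

/-- The partial distance function described by a list of pairs of a vertex and a distance. -/
noncomputable def ofList (l : Fin m → Fin n × Fin n) (v : Fin n) : ℕ∞ :=
  ⨅ i, if (l i).1 = v then (((l i).2 : ℕ) : ℕ∞) else ⊤

theorem IsTable.exists_ofList_eq {D : Fin n → ℕ∞} (hD : IsTable m D) :
    ∃ l : Fin m → Fin n × Fin n, ofList l = D := by
  classical
  obtain ⟨v₀, hv₀⟩ := hD.exists_ne_top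
  obtain ⟨e⟩ : Nonempty ({v // D v ≠ ⊤} ↪ Fin m) := by
    refine Function.Embedding.nonempty_of_card_le ?_
    rw [Fintype.card_fin, ← Nat.card_eq_fintype_card]
    exact hD.ncard_le
  have : Nonempty {v // D v ≠ ⊤} := ⟨⟨v₀, hv₀⟩⟩
  let g : Fin m → {v // D v ≠ ⊤} := Function.invFun e
  have hg : Function.Surjective g := Function.invFun_surjective e.injective
  have hlt : ∀ v : {v // D v ≠ ⊤}, (D v).toNat < n := fun v =>
    by exact_mod_cast (ENat.natCast_toNat v.2).trans_lt (hD.lt_of_ne_top v v.2)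
  refine ⟨fun i => ((g i : Fin n), ⟨(D (g i)).toNat, hlt (g i)⟩), funext fun v => ?_⟩
  refine le_antisymm ?_ (le_iInf fun i => ?_)
  · by_cases hv : D v = ⊤
    · simp [hv]
    · obtain ⟨i, hi⟩ := hg ⟨v, hv⟩
      refine iInf_le_of_le i ?_
      simp [hi, ENat.natCast_toNat hv]
  · simp only
    split_ifs with h
    · rw [← h, ENat.natCast_toNat (g i).2]
    · exact le_top

/-- A list that describes the partial distance function `D`, if there is one. -/
noncomputable def toList [NeZero n] (m : ℕ) (D : Fin n → ℕ∞) : Fin m → Fin n × Fin n :=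
  Function.invFun ofList D

theorem IsTable.ofList_toList [NeZero n] {D : Fin n → ℕ∞} (hD : IsTable m D) :
    ofList (toList m D) = D :=
  Function.invFun_eq hD.exists_ofList_eq

theorem IsTable.exists_toList_fst_eq [NeZero n] {D : Fin n → ℕ∞} (hD : IsTable m D) {v : Fin n}
    (hv : D v ≠ ⊤) : ∃ i, (toList m D i).1 = v := by
  by_contra! h
  refine hv ?_
  rw [← hD.ofList_toList]
  simp [ofList, h]

open Classical in
/-- In two rounds every vertex learns the tables `A` of all the vertices in its own table `Q`. -/
theorem computableIn_fetch_tables [NeZero n] {S : Type} {b t : ℕ}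
    {f : SimpleGraph (Fin n) → Fin n → S} (hf : ComputableIn b t f) (hm : 0 < m)
    (hmn : m * m ≤ 4 * n) (hb : n ^ 12 ≤ 2 ^ b) (A Q : S → Fin n → ℕ∞)
    (hA : ∀ G v, IsTable m (A (f G v))) (hQ : ∀ G v, IsTable m (Q (f G v))) :
    ComputableIn b (t + 2)
      (fun G v => (f G v, fun w => if Q (f G v) w = ⊤ then fun _ => ⊤ else A (f G w))) := by
  have h := (hf.fetch hm hmn (W := Fin n × Fin n) (le_of_eq_of_le (by simp; ring) hb)
    (fun s => toList m (A s)) (fun s i => (toList m (Q s) i).1)).map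
    (fun x => (x.1, fun w => if h : Q x.1 w ≠ ⊤ ∧ ∃ i, (toList m (Q x.1) i).1 = w
      then ofList (x.2 h.2.choose) else fun _ => ⊤))
  refine h.congr fun G v => Prod.ext rfl (funext fun w => ?_)
  by_cases hw : Q (f G v) w = ⊤
  · simp [hw]
  · have hex := (hQ G v).exists_toList_fst_eq hw
    simp only
    rw [dif_pos ⟨hw, hex⟩, if_neg hw]
    rw [hex.choose_spec, (hA G w).ofList_toList]

theorem isTable_nearDist (hm : 0 < m) (H : SimpleGraph (Fin n)) (u : Fin n) (ρ : ℕ) :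
    IsTable m (nearDist H m u ρ) where
  exists_ne_top := ⟨u, nearDist_ne_top.2 (self_mem_nearest hm)⟩
  ncard_le := by
    simp only [nearDist_ne_top]
    exact ncard_nearest_le
  lt_of_ne_top v hv := by
    have hv' := nearDist_ne_top.1 hv
    rw [nearDist_of_mem hv']
    exact edist_lt_of_mem_ball hv'.1

/-! ### Computing truncated distances in the light graph -/

theorem lightGraph_adj {G : SimpleGraph (Fin n)} {v w : Fin n} :
    (lightGraph G).Adj v w ↔ G.Adj v w ∧ ¬ IsHeavy G v ∧ ¬ IsHeavy G w := by
  simp [lightGraph]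

open Classical in
/-- After one round every vertex knows its neighbours in the light graph. A light vertex announces
its own ID and a heavy vertex any other ID; a heavy vertex has a neighbour, so there is one. -/
theorem computableIn_lightNeighbors [NeZero n] {b : ℕ} (hb : n ≤ 2 ^ b) :
    ComputableIn b 1
      (fun (G : SimpleGraph (Fin n)) v => (v, (lightGraph G).neighborSet v)) := by
  have h := (ComputableIn.init b fun (v : Fin n) N => (v, N)).round (M := Fin n) (by simpa using hb)
    (fun s _ => if √(n : ℝ) ≤ (s.2.ncard : ℝ) then Classical.epsilon (· ≠ s.1) else s.1)
    (fun s msg => (s.1, {w | w ∈ s.2 ∧ ¬ √(n : ℝ) ≤ (s.2.ncard : ℝ) ∧ msg w = w}))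
  convert h using 4 with G v
  ext w
  simp only [SimpleGraph.mem_neighborSet, lightGraph_adj, Set.mem_ofPred_eq]
  refine and_congr_right fun hvw => and_congr_right fun _ => ?_
  change ¬ √(n : ℝ) ≤ ((G.neighborSet w).ncard : ℝ) ↔ _
  split_ifs with hw
  · have : Classical.epsilon (· ≠ w) ≠ w :=
      Classical.epsilon_spec (p := (· ≠ w)) ⟨v, hvw.ne⟩
    simp [hw, this]
  · simp [hw]

open Classical in
theorem ballDist_one (H : SimpleGraph (Fin n)) (u : Fin n) :
    ballDist H u 1 = fun v => if v = u then 0 else if v ∈ H.neighborSet u then 1 else ⊤ := by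
  funext v
  simp only [ballDist, ball, Set.mem_ofPred_eq, Nat.cast_one, SimpleGraph.edist_le_one_iff_adj_or_eq,
    SimpleGraph.mem_neighborSet]
  by_cases h : v = u
  · subst h
    simp
  · by_cases h' : H.Adj u v
    · simp [h, h', SimpleGraph.edist_eq_one_iff_adj.2 h']
    · simp [h, h', Ne.symm h]

/-- After `2 * i + 1` rounds every vertex knows its truncated distances to radius `2 ^ i`. -/
theorem computableIn_nearDist [NeZero n] {b : ℕ} (hm : 0 < m) (hmn : m * m ≤ 4 * n)
    (hb : n ^ 12 ≤ 2 ^ b) (i : ℕ) :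
    ComputableIn b (2 * i + 1) (fun (G : SimpleGraph (Fin n)) v =>
      (v, nearDist (lightGraph G) m v 1, nearDist (lightGraph G) m v (2 ^ i))) := by
  classical
  induction i with
  | zero =>
    have h := (computableIn_lightNeighbors ((Nat.le_self_pow (by norm_num) n).trans hb)).map
      (fun s => (s.1, trunc m (fun v => if v = s.1 then 0 else if v ∈ s.2 then 1 else ⊤),
        trunc m (fun v => if v = s.1 then 0 else if v ∈ s.2 then 1 else ⊤)))
    refine h.congr fun G v => ?_
    simp only [← trunc_ballDist, ballDist_one, pow_zero]
    congr!
  | succ i ih =>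
    have h := (computableIn_fetch_tables ih hm hmn hb (fun s => s.2.2) (fun s => s.2.2)
      (fun G v => isTable_nearDist hm _ _ _) (fun G v => isTable_nearDist hm _ _ _)).map
      (fun s => (s.1.1, s.1.2.1, trunc m (fun v => ⨅ w, s.1.2.2 w + s.2 w v)))
    refine h.congr fun G v => Prod.ext rfl (Prod.ext rfl ?_)
    simp only
    rw [pow_succ, mul_two, ← trunc_minPlus_nearDist]
    congr 1
    funext x
    refine iInf_congr fun w => ?_
    split_ifs with hw
    · simp [hw]
    · rfl

/-! ### The tree given by parent pointers -/

/-- The graph on `N` that joins every vertex other than the root `u` to its parent. -/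
def parentTree (u : Fin n) (N : Set (Fin n)) (parent : Fin n → Fin n) :
    (⊤ : SimpleGraph (Fin n)).Subgraph where
  verts := N
  Adj v w := v ∈ N ∧ w ∈ N ∧ v ≠ w ∧ ((v ≠ u ∧ parent v = w) ∨ (w ≠ u ∧ parent w = v))
  adj_sub h := h.2.2.1
  edge_vert h := h.1
  symm := ⟨fun _ _ h => ⟨h.2.1, h.1, h.2.2.1.symm, h.2.2.2.symm⟩⟩

theorem isBFSTreeOn_parentTree {H : SimpleGraph (Fin n)} {u : Fin n} {N : Set (Fin n)}
    {parent : Fin n → Fin n} (hu : u ∈ N) (hN : ∀ v ∈ N, H.edist u v ≠ ⊤)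
    (hparent : ∀ v ∈ N, v ≠ u →
      parent v ∈ N ∧ H.Adj (parent v) v ∧ H.edist u (parent v) + 1 = H.edist u v) :
    IsBFSTreeOn H u N (parentTree u N parent) := by
  classical
  set T := parentTree u N parent with hT
  have hadj : ∀ v ∈ N, v ≠ u → T.Adj (parent v) v := fun v hv hvu =>
    ⟨(hparent v hv hvu).1, hv, (hparent v hv hvu).2.1.ne, Or.inr ⟨hvu, rfl⟩⟩
  have hle : T.spanningCoe ≤ H := by
    rintro v w ⟨hv, hw, -, ⟨hvu, rfl⟩ | ⟨hwu, rfl⟩⟩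
    · exact (hparent v hv hvu).2.1.symm
    · exact (hparent w hw hwu).2.1
  -- Following parents, a vertex at distance `d` reaches the root after `d` steps.
  have hwalk : ∀ (d : ℕ) (v : Fin n) (hv : v ∈ N), H.edist u v = d →
      T.spanningCoe.edist u v ≤ d ∧ T.coe.Reachable ⟨u, hu⟩ ⟨v, hv⟩ := by
    intro d
    induction d with
    | zero =>
      intro v hv h
      obtain rfl : u = v := (H.edist_eq_zero_iff).1 h
      simp
    | succ d ih =>
      intro v hv h
      have hvu : v ≠ u := by
        rintro rfl
        simp [SimpleGraph.edist_self] at h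
        exact absurd h.symm (by exact_mod_cast Nat.succ_ne_zero d)
      obtain ⟨hp, -, hd⟩ := hparent v hv hvu
      have hd' : H.edist u (parent v) = d := by
        rw [h, Nat.cast_succ] at hd
        exact WithTop.add_right_cancel ENat.one_ne_top hd
      obtain ⟨h₁, h₂⟩ := ih (parent v) hp hd'
      constructor
      · refine le_trans (SimpleGraph.edist_triangle (v := parent v)) ?_
        rw [Nat.cast_succ]
        exact add_le_add h₁ (SimpleGraph.edist_eq_one_iff_adj.2 (hadj v hv hvu)).le
      · refine h₂.trans (SimpleGraph.Adj.reachable ?_)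
        exact hadj v hv hvu
  have hwalk' : ∀ v (hv : v ∈ N),
      T.spanningCoe.edist u v ≤ H.edist u v ∧ T.coe.Reachable ⟨u, hu⟩ ⟨v, hv⟩ := by
    intro v hv
    have := hwalk _ v hv (ENat.natCast_toNat (hN v hv)).symm
    rwa [ENat.natCast_toNat (hN v hv)] at this
  have hconn : T.coe.Connected := by
    have : Nonempty T.verts := ⟨⟨u, hu⟩⟩
    refine SimpleGraph.Connected.mk fun v w => ?_
    exact (hwalk' v v.2).2.symm.trans (hwalk' w w.2).2
  refine ⟨rfl, hle, ?_, fun v hv => (hwalk' v hv).1.antisymm (SimpleGraph.edist_anti hle)⟩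
  rw [SimpleGraph.isTree_iff_connected_and_card]
  refine ⟨hconn, le_antisymm ?_ hconn.card_vert_le_card_edgeSet_add_one⟩
  -- Every edge joins a vertex other than the root to its parent, so there are few edges.
  let r : T.verts := ⟨u, hu⟩
  let edge : {v : T.verts // v ≠ r} → T.coe.edgeSet := fun v =>
    ⟨s(⟨parent v.1, (hparent _ v.1.2 fun h => v.2 (Subtype.ext h)).1⟩, v.1),
      hadj v.1 v.1.2 fun h => v.2 (Subtype.ext h)⟩
  have hsurj : Function.Surjective edge := by
    rintro ⟨e, he⟩
    induction e using Sym2.ind with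
    | _ v w =>
      obtain ⟨-, -, -, ⟨hvu, h⟩ | ⟨hwu, h⟩⟩ := he
      · refine ⟨⟨v, fun h => hvu (congrArg Subtype.val h)⟩, Subtype.ext ?_⟩
        simp only [edge, h]
        exact Sym2.eq_swap
      · refine ⟨⟨w, fun h => hwu (congrArg Subtype.val h)⟩, Subtype.ext ?_⟩
        simp only [edge, h]
  have hcard := Nat.card_le_card_of_surjective edge hsurj
  have hcompl : Nat.card {v : T.verts // v ≠ r} + 1 = Nat.card T.verts := by
    rw [Nat.card_eq_fintype_card, Nat.card_eq_fintype_card, Fintype.card_subtype_compl,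
      Fintype.card_subtype_eq]
    exact Nat.sub_add_cancel (Fintype.card_pos_iff.2 ⟨r⟩)
  omega

/-! ### The algorithm -/

/-- Every truncated neighbourhood is closed under suitable parents, and the edge to such a parent
is visible in the truncated neighbourhood of radius `1` of the parent. -/
theorem exists_parent {H : SimpleGraph (Fin n)} {u v : Fin n} {r : ℕ}
    (hv : v ∈ nearest H u r m) (hvu : v ≠ u) :
    ∃ p ∈ nearest H u r m, nearDist H m p 1 v = 1 ∧ H.edist u p + 1 = H.edist u v := by
  obtain ⟨d, hd⟩ : ∃ d : ℕ, H.edist u v = (d + 1 : ℕ) := by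
    obtain ⟨d, hd⟩ := ENat.ne_top_iff_exists.1 (ne_top_of_mem_ball hv.1)
    cases d with
    | zero => exact absurd (SimpleGraph.edist_eq_zero_iff.1 hd.symm) hvu.symm
    | succ d => exact ⟨d, hd.symm⟩
  have hdr : d + 1 ≤ r := by
    have : ((d + 1 : ℕ) : ℕ∞) ≤ r := hd ▸ hv.1
    exact_mod_cast this
  obtain ⟨p, hp, hpv, h⟩ := exists_between (ρ := d) (σ := 1) hd.le
  have hpr : p ∈ ball H u r := ball_mono (by omega) hp
  have hpne : p ≠ v := by
    rintro rfl
    have : H.edist u p ≤ d := hp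
    rw [hd] at this
    exact absurd this (by exact_mod_cast Nat.not_succ_le_self d)
  have hone : H.edist p v = 1 :=
    le_antisymm hpv (Order.one_le_iff_pos.2 (SimpleGraph.edist_pos_of_ne hpne))
  refine ⟨p, mem_nearest_of_between_left hv h le_rfl hpr, ?_, ?_⟩
  · rw [nearDist_of_mem (mem_nearest_of_between_right hv h hpv), hone]
  · refine le_antisymm (by rwa [hone] at h) ?_
    rw [← hone]
    exact H.edist_triangle

/-- Once the truncated distances are known to a radius that is large enough, two more rounds yield
the truncated BFS trees: every vertex fetches the truncated neighbourhoods of radius `1` of its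
nearest vertices and picks parents among them. -/
theorem exists_computableIn_isBFSTreeOn [NeZero n] {b : ℕ} (hm : 0 < m) (hmn : m * m ≤ 4 * n)
    (hb : n ^ 12 ≤ 2 ^ b) {r i : ℕ} (hr : r ≤ 2 ^ i) :
    ∃ T : SimpleGraph (Fin n) → Fin n → (⊤ : SimpleGraph (Fin n)).Subgraph,
      ComputableIn b (2 * i + 3) T ∧
      ∀ G u, IsBFSTreeOn (lightGraph G) u (nearest (lightGraph G) u r m) (T G u) := by
  classical
  have h := (computableIn_fetch_tables (computableIn_nearDist hm hmn hb i) hm hmn hb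
      (fun s => s.2.1) (fun s => s.2.2)
      (fun G v => isTable_nearDist hm _ _ _) (fun G v => isTable_nearDist hm _ _ _)).map
    (fun s => parentTree s.1.1 {v | s.1.2.2 v ≤ r} fun v =>
      Classical.epsilon fun p => s.1.2.2 p ≤ r ∧ s.2 p v = 1 ∧ s.1.2.2 p + 1 = s.1.2.2 v)
  refine ⟨_, h, fun G u => ?_⟩
  simp only
  set H := lightGraph G
  have hset : {v | nearDist H m u (2 ^ i) v ≤ r} = nearest H u r m := by
    ext v
    exact (mem_nearest_iff_of_le hr).symm
  rw [hset]
  have hdist : ∀ v ∈ nearest H u r m, nearDist H m u (2 ^ i) v = H.edist u v := fun v hv =>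
    nearDist_of_mem (nearDist_ne_top.1
      (ne_top_of_le_ne_top (ENat.natCast_ne_top r) ((mem_nearest_iff_of_le hr).1 hv)))
  refine isBFSTreeOn_parentTree (self_mem_nearest hm) (fun v hv => ne_top_of_mem_ball hv.1) ?_
  intro v hv hvu
  obtain ⟨p, hp, hpv, hpd⟩ := exists_parent hv hvu
  have hex : ∃ p, nearDist H m u (2 ^ i) p ≤ r ∧
      (if nearDist H m u (2 ^ i) p = ⊤ then (fun _ => ⊤) else nearDist H m p 1) v = 1 ∧
      nearDist H m u (2 ^ i) p + 1 = nearDist H m u (2 ^ i) v := by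
    have hle := (mem_nearest_iff_of_le hr).1 hp
    refine ⟨p, hle, ?_, by rw [hdist p hp, hdist v hv, hpd]⟩
    rw [if_neg (ne_top_of_le_ne_top (ENat.natCast_ne_top r) hle), hpv]
  obtain ⟨h₁, h₂, h₃⟩ := Classical.epsilon_spec hex
  set q := Classical.epsilon fun p => nearDist H m u (2 ^ i) p ≤ r ∧
      (if nearDist H m u (2 ^ i) p = ⊤ then (fun _ => ⊤) else nearDist H m p 1) v = 1 ∧
      nearDist H m u (2 ^ i) p + 1 = nearDist H m u (2 ^ i) v
  have hq : q ∈ nearest H u r m := (mem_nearest_iff_of_le hr).2 h₁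
  rw [if_neg (ne_top_of_le_ne_top (ENat.natCast_ne_top r) h₁)] at h₂
  refine ⟨hq, ?_, by rw [← hdist q hq, ← hdist v hv, h₃]⟩
  rw [← SimpleGraph.edist_eq_one_iff_adj, ← h₂, nearDist_of_mem]
  exact nearDist_ne_top.1 (by rw [h₂]; exact ENat.one_ne_top)

theorem IsSizeBound.pos {n k m : ℕ} (hn : 0 < n) (hk : 2 ≤ k) (h : IsSizeBound n k m) : 0 < m := by
  have hk' : (1 : ℝ) / k ≤ 1 / 2 := by
    apply one_div_le_one_div_of_le (by norm_num)
    exact_mod_cast hk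
  have h1 : (1 : ℝ) ≤ (n : ℝ) ^ ((1 : ℝ) / 2 - 1 / (k : ℝ)) :=
    Real.one_le_rpow (by exact_mod_cast hn) (by linarith)
  rcases h with rfl | rfl
  · exact Nat.floor_pos.2 h1
  · exact Nat.ceil_pos.2 (by linarith)

theorem IsSizeBound.mul_self_le {n k m : ℕ} (hn : 0 < n) (h : IsSizeBound n k m) :
    m * m ≤ 4 * n := by
  have hn' : (1 : ℝ) ≤ n := by exact_mod_cast hn
  set x : ℝ := (n : ℝ) ^ ((1 : ℝ) / 2 - 1 / (k : ℝ)) with hx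
  have hx0 : 0 ≤ x := by positivity
  have hxs : x ≤ √n := by
    rw [Real.sqrt_eq_rpow]
    exact Real.rpow_le_rpow_of_exponent_le hn' (sub_le_self _ (by positivity))
  have hs : 1 ≤ √(n : ℝ) := Real.one_le_sqrt.2 hn'
  have hm : (m : ℝ) ≤ 2 * √n := by
    rcases h with rfl | rfl
    · linarith [Nat.floor_le hx0]
    · linarith [Nat.ceil_lt_add_one hx0]
  have : (m : ℝ) * m ≤ 4 * n := by
    calc (m : ℝ) * m ≤ (2 * √n) * (2 * √n) := by gcongr
      _ = 4 * (√n * √n) := by ring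
      _ = 4 * n := by rw [Real.mul_self_sqrt (by positivity)]
  exact_mod_cast this

theorem radius_le_two_pow (k : ℕ) : radius k ≤ 2 ^ Nat.log 2 k := by
  have h : k < 2 ^ (Nat.log 2 k + 1) := Nat.lt_pow_succ_log_self (by norm_num) k
  rw [pow_succ] at h
  unfold radius
  split_ifs <;> omega

theorem rounds_le_log {k : ℕ} (hk : 3 ≤ k) :
    ((2 * Nat.log 2 k + 3 : ℕ) : ℝ) ≤ (2 / Real.log 2 + 3) * Real.log k := by
  have h1 : (1 : ℝ) ≤ Real.log k := by
    rw [Real.le_log_iff_exp_le (by positivity)]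
    refine Real.exp_one_lt_three.le.trans (by exact_mod_cast hk)
  have h2 : (Nat.log 2 k : ℝ) ≤ Real.log k / Real.log 2 := by
    simpa [Real.logb] using Real.natLog_le_logb k 2
  push_cast
  calc (2 : ℝ) * Nat.log 2 k + 3 ≤ 2 * (Real.log k / Real.log 2) + 3 * Real.log k := by linarith
    _ = _ := by ring

end NearestNeighbors

theorem mainTheorem8 :
    ∃ (c : ℕ) (C : ℝ)
      (A : (n k m : ℕ) →
        CliqueAlgorithm n (c * Nat.clog 2 n) ((⊤ : SimpleGraph (Fin n)).Subgraph))
      (R : ℕ → ℕ),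
      (∀ k : ℕ, 6 ≤ k → (R k : ℝ) ≤ C * Real.log k) ∧
      ∀ n k m : ℕ, 6 ≤ k → NearestNeighbors.IsSizeBound n k m →
        ∀ (G : SimpleGraph (Fin n)) (u : Fin n), ¬ NearestNeighbors.IsHeavy G u →
          NearestNeighbors.IsBFSTreeOn (NearestNeighbors.lightGraph G) u
            (NearestNeighbors.nearest (NearestNeighbors.lightGraph G) u
              (NearestNeighbors.radius k) m)
            ((A n k m).outputAfter G (R k) u) := by
  open NearestNeighbors in
  have main : ∀ n k m : ℕ,
      ∃ A : CliqueAlgorithm n (12 * Nat.clog 2 n) ((⊤ : SimpleGraph (Fin n)).Subgraph),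
        6 ≤ k → IsSizeBound n k m → ∀ G u, IsBFSTreeOn (lightGraph G) u
          (nearest (lightGraph G) u (radius k) m) (A.outputAfter G (2 * Nat.log 2 k + 3) u) := by
    intro n k m
    by_cases h : 0 < n ∧ 6 ≤ k ∧ IsSizeBound n k m
    · obtain ⟨hn, hk, hm⟩ := h
      have : NeZero n := ⟨hn.ne'⟩
      have hb : n ^ 12 ≤ 2 ^ (12 * Nat.clog 2 n) := by
        rw [mul_comm, pow_mul]
        exact Nat.pow_le_pow_left (Nat.le_pow_clog (by norm_num) n) 12
      obtain ⟨T, ⟨A, hA⟩, hT⟩ := exists_computableIn_isBFSTreeOn (hm.pos hn (by omega))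
        (hm.mul_self_le hn) hb (radius_le_two_pow k)
      exact ⟨A, fun _ _ G u => by rw [hA]; exact hT G u⟩
    · obtain ⟨A, -⟩ := CliqueAlgorithm.ComputableIn.init (12 * Nat.clog 2 n)
        fun (_ : Fin n) _ => (⊥ : (⊤ : SimpleGraph (Fin n)).Subgraph)
      exact ⟨A, fun hk hm G u => absurd ⟨u.pos, hk, hm⟩ h⟩
  choose A hA using main
  exact ⟨12, 2 / Real.log 2 + 3, A, fun k => 2 * Nat.log 2 k + 3,
    fun k hk => NearestNeighbors.rounds_le_log (by omega),
    fun n k m hk hm G u _ => hA n k m hk hm G u⟩
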